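/- Let $K\ge 2$ and $\Delta>0$. For $i\in[K]$ let $\nu^{(i)}=\mathcal N(\mu^{(i)},I_K)$ be the Gaussian bandit instance with $\mu^{(i)}_i=\Delta$ and $\mu^{(i)}_j=0$ for $j\ne i$. In round $t\ge1$ a strategy pulls an arm $I_t\in[K]$ and observes a reward $X_t$ drawn from the distribution of arm $I_t$, independently of the past. With $\mathcal F_t=\sigma(I_1,X_1,\dots,I_t,X_t)$, a strategy consists of a sampling rule $(I_t)_{t\ge1}$ such that $I_t$ is $\mathcal F_{t-1}$-measurable, a stopping time $\tau_\delta$ with respect to $(\mathcal F_t)$, possibly infinite, and an $\mathcal F_{\tau_\delta}$-measurable recommendation $\hat\imath\in[K]$. The strategy is $\delta$-correct if $\mathbb P_{\mu}(\tau_\delta<\infty,\ \hat\imath\ne i^\star(\mu))\le\delta$ for every Gaussian instance with unit variance whose mean vector $\mu\in\mathbb R^K$ is unimodal, i.e. has a unique maximum, attained at $i^\star(\mu)$, with $\mu_j\le\mu_{j+1}$ for $j<i^\star(\mu)$ and $\mu_j\ge\mu_{j+1}$ for $i^\star(\mu)\le j<K$. Then, for any $\delta\le 1/4$ and any $\delta$-correct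 strategy, $$\frac1K\sum_{i\in[K]}\mathbb E_{\nu^{(i)}}[\tau_\delta]\ \ge\ \frac{K}{64\Delta^2},$$ where the expectations take values in $[0,\infty]$. In particular, there exists $i\in[K]$ such that $\mathbb E_{\nu^{(i)}}[\tau_\delta]\ge \frac{K}{64\Delta^2}$. -/

import Mathlib

open MeasureTheory ProbabilityTheory
open scoped ENNReal

namespace UnimodalBAI

/-- Reward tables of a `K`-armed bandit: the entry `(k, n)` is the reward obtained the
`(n + 1)`-st time that arm `k` is pulled. -/
abbrev RewardTable (K : ℕ) : Type := Fin K × ℕ → ℝ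

/-- The Gaussian bandit instance with unit variance and mean vector `μ`: all the rewards are
independent and those of arm `k` have law `N(μ k, 1)`. -/
noncomputable def gaussianBandit {K : ℕ} (μ : Fin K → ℝ) : Measure (RewardTable K) :=
  Measure.infinitePi fun p : Fin K × ℕ => gaussianReal (μ p.1) 1

/-- The mean vector of the spike instance: arm `i` has mean `Δ`, all others have mean `0`. -/
def spikeMean {K : ℕ} (Δ : ℝ) (i : Fin K) : Fin K → ℝ := fun j => if j = i then Δ else 0

/-- Arm `i` is the unique arm with the highest mean. -/
def IsBestArm {K : ℕ} (μ : Fin K → ℝ) (i : Fin K) : Prop := ∀ j, j ≠ i → μ j < μ i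

/-- The unimodal mean vectors: there is a unique maximum, the means are non-decreasing up to it
and non-increasing after it. -/
def unimodalMeans (K : ℕ) : Set (Fin K → ℝ) :=
  {μ | ∃ i, IsBestArm μ i ∧ MonotoneOn μ (Set.Iic i) ∧ AntitoneOn μ (Set.Ici i)}

section Interaction

variable {K : ℕ} (arm : ℕ → RewardTable K → Fin K)

/-- Number of pulls of arm `k` during the first `t` rounds, when `arm s` is the arm pulled in
round `s` (rounds are numbered from `0`). -/
def pullCount (t : ℕ) (k : Fin K) (ω : RewardTable K) : ℕ :=
  ((Finset.range t).filter fun s => arm s ω = k).card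

/-- The reward observed in round `t`. -/
def reward (t : ℕ) (ω : RewardTable K) : ℝ :=
  ω (arm t ω, pullCount arm t (arm t ω) ω)

/-- The σ-algebra generated by the arms and the rewards of the first `t` rounds. -/
@[reducible]
def historySigma (t : ℕ) : MeasurableSpace (RewardTable K) :=
  ⨆ s : ℕ, ⨆ _ : s < t,
    (MeasurableSpace.comap (arm s) inferInstance ⊔
      MeasurableSpace.comap (reward arm s) inferInstance)

end Interaction

/-- A sampling rule: the arm of each round is measurable with respect to the σ-algebra generated
by the arms and the rewards of the previous rounds. -/
structure SamplingRule (K : ℕ) where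
  arm : ℕ → RewardTable K → Fin K
  predictable : ∀ t, Measurable[historySigma arm t] (arm t)

theorem measurable_reward {K : ℕ} {arm : ℕ → RewardTable K → Fin K} {t : ℕ}
    (h : ∀ s ≤ t, Measurable (arm s)) : Measurable (reward arm t) := by
  have hc : ∀ k, Measurable (pullCount arm t k) := by
    intro k
    have he : pullCount arm t k =
        fun ω => ∑ s ∈ Finset.range t, if arm s ω = k then 1 else 0 := by
      funext ω
      exact Finset.card_filter _ _
    rw [he]
    refine Finset.measurable_sum _ fun s hs => ?_
    exact Measurable.ite (h s (Finset.mem_range.1 hs).le (measurableSet_singleton k))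
      measurable_const measurable_const
  have hcell : Measurable fun ω : RewardTable K => (arm t ω, pullCount arm t (arm t ω) ω) := by
    refine (h t le_rfl).prodMk ?_
    have h2 : Measurable fun q : Fin K × RewardTable K => pullCount arm t q.1 q.2 :=
      measurable_from_prod_countable_right hc
    exact h2.comp ((h t le_rfl).prodMk measurable_id)
  have heval : Measurable fun q : (Fin K × ℕ) × RewardTable K => q.2 q.1 :=
    measurable_from_prod_countable_right fun p => measurable_pi_apply p
  exact heval.comp (hcell.prodMk measurable_id)

theorem SamplingRule.measurable_arm {K : ℕ} (S : SamplingRule K) (t : ℕ) :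
    Measurable (S.arm t) := by
  induction t using Nat.strong_induction_on with
  | _ t ih =>
    refine (S.predictable t).mono (iSup₂_le fun s hs => sup_le (ih s hs).comap_le ?_) le_rfl
    exact (measurable_reward fun r hr => ih r (lt_of_le_of_lt hr hs)).comap_le

/-- The filtration of the observations: its `t`-th σ-algebra is generated by the arms and the
rewards of the first `t` rounds. -/
def SamplingRule.filtration {K : ℕ} (S : SamplingRule K) :
    Filtration ℕ (inferInstance : MeasurableSpace (RewardTable K)) where
  seq := historySigma S.arm
  mono' := fun _ _ hst => iSup₂_le fun r hr =>
    le_iSup₂_of_le (f := fun r (_ : r < _) => MeasurableSpace.comap (S.arm r) inferInstance ⊔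
      MeasurableSpace.comap (reward S.arm r) inferInstance) r (lt_of_lt_of_le hr hst) le_rfl
  le' := fun _ => iSup₂_le fun r _ => sup_le (S.measurable_arm r).comap_le
    (measurable_reward fun q _ => S.measurable_arm q).comap_le

/-- A strategy: a sampling rule, a stopping time `τ` of the filtration of the observations (the
number of rounds before termination, possibly infinite), and a recommendation that is measurable
with respect to the σ-algebra of the events prior to `τ`. -/
structure Strategy (K : ℕ) extends SamplingRule K where
  τ : RewardTable K → WithTop ℕ
  isStoppingTime : IsStoppingTime toSamplingRule.filtration τ
  answer : RewardTable K → Fin K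
  measurable_answer : Measurable[isStoppingTime.measurableSpace] answer

/-- On every Gaussian instance with unit variance and unimodal means, the probability of stopping
and not recommending the best arm is at most `δ`. -/
def Strategy.IsDeltaCorrect {K : ℕ} (A : Strategy K) (δ : ℝ) : Prop :=
  ∀ μ ∈ unimodalMeans K, ∀ i, IsBestArm μ i →
    (gaussianBandit μ).real {ω | A.τ ω < ⊤ ∧ A.answer ω ≠ i} ≤ δ

/-- The expected sample complexity `E_μ[τ]`, with values in `[0, ∞]`. -/
noncomputable def Strategy.expectedSamples {K : ℕ} (A : Strategy K) (μ : Fin K → ℝ) : ℝ≥0∞ :=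
  ∫⁻ ω, ENat.toENNReal (A.τ ω) ∂(gaussianBandit μ)

end UnimodalBAI

/-! Compare every spike instance with the instance whose means are all `0`, under law `P₀`. Let
`A_k` be the event of stopping within `t` rounds with answer `k`. These events are disjoint, so
their `P₀`-probabilities sum to at most `1`. Each round pulls one arm and hence informs about one
spike only: the divergences of `P₀` from the `K` spike laws on the first `t` rounds sum to `tΔ²/2`
(`sum_integral_logLikelihood_spikeMean`). A Donsker–Varadhan type bound (`integral_le_of_event`)
turns this into an upper bound on the sum over `k` of the probability of `A_k` under spike `k`.

Correctness forces each such probability to be at least `1 - δ` minus the probability of `t < τ`. So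
the latter are large on average while `t` is below order `K/Δ²`, and summing these tails over `t`
bounds `E[τ]` from below, whether or not `τ` is finite.

The change of measure (`lintegral_change_of_measure`) is proved directly on reward tables: the cell
read in round `t` depends only on the earlier history, so its entry may be redrawn independently
(`lintegral_resample`). -/

namespace UnimodalBAI

/-! ### Histories and the cell read in each round. -/

/-- Two reward tables that produce the same arms and rewards during the first `t` rounds. -/
def SameHistory {K : ℕ} (arm : ℕ → RewardTable K → Fin K) (t : ℕ) (ω ω' : RewardTable K) : Prop :=
  ∀ s < t, arm s ω = arm s ω' ∧ reward arm s ω = reward arm s ω'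

theorem SameHistory.symm {K t : ℕ} {arm : ℕ → RewardTable K → Fin K} {ω ω' : RewardTable K}
    (h : SameHistory arm t ω ω') : SameHistory arm t ω' ω :=
  fun s hs => ⟨(h s hs).1.symm, (h s hs).2.symm⟩

theorem SameHistory.trans {K t : ℕ} {arm : ℕ → RewardTable K → Fin K} {ω ω' ω'' : RewardTable K}
    (h : SameHistory arm t ω ω') (h' : SameHistory arm t ω' ω'') : SameHistory arm t ω ω'' :=
  fun s hs => ⟨(h s hs).1.trans (h' s hs).1, (h s hs).2.trans (h' s hs).2⟩

theorem SameHistory.mem_iff {K t : ℕ} {arm : ℕ → RewardTable K → Fin K} {ω ω' : RewardTable K}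
    (h : SameHistory arm t ω ω') {B : Set (RewardTable K)} (hB : MeasurableSet[historySigma arm t] B) :
    ω ∈ B ↔ ω' ∈ B := by
  -- The sets that do not separate `ω` from `ω'` form a σ-algebra, and it contains the generators of
  -- the history.
  let m : MeasurableSpace (RewardTable K) :=
    { MeasurableSet' := fun B => ω ∈ B ↔ ω' ∈ B
      measurableSet_empty := by simp
      measurableSet_compl := fun B hB => by simp [hB]
      measurableSet_iUnion := fun f hf => by
        simp only [Set.mem_iUnion]
        exact exists_congr hf }
  have hle : historySigma arm t ≤ m := by
    refine iSup₂_le fun s hs => sup_le ?_ ?_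
    · rintro _ ⟨C, -, rfl⟩
      change arm s ω ∈ C ↔ arm s ω' ∈ C
      rw [(h s hs).1]
    · rintro _ ⟨C, -, rfl⟩
      change reward arm s ω ∈ C ↔ reward arm s ω' ∈ C
      rw [(h s hs).2]
  exact hle B hB

theorem SameHistory.pullCount_eq {K t : ℕ} {arm : ℕ → RewardTable K → Fin K} {ω ω' : RewardTable K}
    (h : SameHistory arm t ω ω') (k : Fin K) : pullCount arm t k ω = pullCount arm t k ω' := by
  unfold pullCount
  congr 1
  refine Finset.filter_congr fun s hs => ?_
  rw [(h s (Finset.mem_range.1 hs)).1]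

namespace SamplingRule

variable {K : ℕ} (S : SamplingRule K)

theorem arm_eq_of_sameHistory {t : ℕ} {ω ω' : RewardTable K} (h : SameHistory S.arm t ω ω') :
    S.arm t ω = S.arm t ω' :=
  ((h.mem_iff (S.predictable t (measurableSet_singleton (S.arm t ω)))).1 rfl).symm

/-- The cell of the reward table that is read in round `t`. -/
def cell (t : ℕ) (ω : RewardTable K) : Fin K × ℕ :=
  (S.arm t ω, pullCount S.arm t (S.arm t ω) ω)

theorem reward_eq (t : ℕ) (ω : RewardTable K) : reward S.arm t ω = ω (S.cell t ω) := rfl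

theorem cell_eq_of_sameHistory {t : ℕ} {ω ω' : RewardTable K} (h : SameHistory S.arm t ω ω') :
    S.cell t ω = S.cell t ω' := by
  unfold cell
  rw [S.arm_eq_of_sameHistory h, h.pullCount_eq]

theorem cell_ne {s t : ℕ} (hst : s < t) (ω : RewardTable K) : S.cell s ω ≠ S.cell t ω := by
  intro h
  have h1 : S.arm s ω = S.arm t ω := congrArg Prod.fst h
  have h2 : pullCount S.arm s (S.arm s ω) ω = pullCount S.arm t (S.arm t ω) ω :=
    congrArg Prod.snd h
  rw [h1] at h2
  refine absurd h2 (ne_of_lt (Finset.card_lt_card ?_))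
  rw [Finset.ssubset_iff_of_subset
    (Finset.filter_subset_filter _ (Finset.range_mono hst.le))]
  exact ⟨s, by simp [hst, h1], by simp⟩

/-- Earlier rounds read other cells (`cell_ne`), so the edit goes unnoticed round after round. -/
theorem sameHistory_update (t : ℕ) (ω : RewardTable K) (x : ℝ) :
    SameHistory S.arm t (Function.update ω (S.cell t ω) x) ω := by
  suffices ∀ r ≤ t, SameHistory S.arm r (Function.update ω (S.cell t ω) x) ω from this t le_rfl
  intro r
  induction r with
  | zero => exact fun _ s hs => absurd hs (Nat.not_lt_zero s)
  | succ r ih =>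
    intro hr s hs
    have hrr := ih (Nat.le_of_succ_le hr)
    rcases Nat.lt_succ_iff_lt_or_eq.1 hs with h | rfl
    · exact hrr s h
    · refine ⟨S.arm_eq_of_sameHistory hrr, ?_⟩
      rw [S.reward_eq, S.reward_eq, S.cell_eq_of_sameHistory hrr,
        Function.update_of_ne (S.cell_ne hr ω)]

theorem cell_update (t : ℕ) (ω : RewardTable K) (x : ℝ) :
    S.cell t (Function.update ω (S.cell t ω) x) = S.cell t ω :=
  S.cell_eq_of_sameHistory (S.sameHistory_update t ω x)

theorem cell_update_eq_iff (t : ℕ) (ω : RewardTable K) (c : Fin K × ℕ) (x : ℝ) :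
    S.cell t (Function.update ω c x) = c ↔ S.cell t ω = c := by
  constructor
  · intro h
    -- Writing the old entry back recovers `ω`.
    have := S.cell_update t (Function.update ω c x) (ω c)
    rw [h, Function.update_idem, Function.update_eq_self] at this
    exact this
  · rintro rfl
    exact S.cell_update t ω x

theorem reward_update (t : ℕ) (ω : RewardTable K) (x : ℝ) :
    reward S.arm t (Function.update ω (S.cell t ω) x) = x := by
  rw [S.reward_eq, S.cell_update, Function.update_self]

theorem sameHistory_update_succ {t : ℕ} {ω ω' : RewardTable K} (h : SameHistory S.arm t ω ω')
    (x : ℝ) : SameHistory S.arm (t + 1) (Function.update ω (S.cell t ω) x)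
      (Function.update ω' (S.cell t ω') x) := by
  have h1 := ((S.sameHistory_update t ω x).trans h).trans (S.sameHistory_update t ω' x).symm
  intro s hs
  rcases Nat.lt_succ_iff_lt_or_eq.1 hs with hs | rfl
  · exact h1 s hs
  · exact ⟨S.arm_eq_of_sameHistory h1, by rw [S.reward_update, S.reward_update]⟩

theorem measurable_pullCount (t : ℕ) (k : Fin K) : Measurable (pullCount S.arm t k) := by
  have he : pullCount S.arm t k =
      fun ω => ∑ s ∈ Finset.range t, if S.arm s ω = k then 1 else 0 := by
    funext ω
    exact Finset.card_filter _ _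
  rw [he]
  exact Finset.measurable_sum _ fun s _ =>
    Measurable.ite (S.measurable_arm s (measurableSet_singleton k)) measurable_const
      measurable_const

theorem measurable_cell (t : ℕ) : Measurable (S.cell t) := by
  have h2 : Measurable fun q : Fin K × RewardTable K => pullCount S.arm t q.1 q.2 :=
    measurable_from_prod_countable_right (S.measurable_pullCount t)
  exact (S.measurable_arm t).prodMk (h2.comp ((S.measurable_arm t).prodMk measurable_id))

end SamplingRule

/-! ### Redrawing one reward leaves the law of the table unchanged. -/

theorem measurable_update_uncurry {K : ℕ} (c : Fin K × ℕ) :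
    Measurable fun q : RewardTable K × ℝ => Function.update q.1 c q.2 := by
  refine measurable_pi_lambda _ fun a => ?_
  by_cases h : a = c
  · subst h
    simpa using measurable_snd
  · simp only [Function.update_of_ne h]
    exact (measurable_pi_apply a).comp measurable_fst

instance {K : ℕ} (μ : Fin K → ℝ) : IsProbabilityMeasure (gaussianBandit μ) := by
  unfold gaussianBandit
  infer_instance

theorem map_update_gaussianBandit {K : ℕ} (μ : Fin K → ℝ) (c : Fin K × ℕ) :
    ((gaussianBandit μ).prod (gaussianReal (μ c.1) 1)).map
      (fun q => Function.update q.1 c q.2) = gaussianBandit μ := by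
  refine Measure.eq_infinitePi _ fun s t ht => ?_
  have hpre : (fun q : RewardTable K × ℝ => Function.update q.1 c q.2) ⁻¹' Set.pi s t =
      (Set.pi (s.erase c) t) ×ˢ (if c ∈ s then t c else Set.univ) := by
    ext ⟨ω, x⟩
    simp only [Set.mem_preimage, Set.mem_pi, Finset.mem_coe, Set.mem_prod, Finset.mem_erase]
    constructor
    · intro h
      refine ⟨fun i hi => by simpa [Function.update_of_ne hi.1] using h i hi.2, ?_⟩
      split_ifs with hc
      · simpa using h c hc
      · trivial
    · rintro ⟨h1, h2⟩ i hi
      by_cases hic : i = c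
      · subst hic
        simpa [hi] using h2
      · simpa [Function.update_of_ne hic] using h1 i ⟨hic, hi⟩
  rw [Measure.map_apply (measurable_update_uncurry c)
    (MeasurableSet.pi s.countable_toSet fun i _ => ht i), hpre, Measure.prod_prod, gaussianBandit,
    Measure.infinitePi_pi _ fun i _ => ht i]
  split_ifs with hc
  · rw [mul_comm, Finset.mul_prod_erase s (fun i => gaussianReal (μ i.1) 1 (t i)) hc]
  · rw [Finset.erase_eq_of_notMem hc, measure_univ, mul_one]

theorem lintegral_update_gaussianBandit {K : ℕ} (μ : Fin K → ℝ) (c : Fin K × ℕ)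
    {f : RewardTable K → ℝ≥0∞} (hf : Measurable f) :
    ∫⁻ ω, f ω ∂gaussianBandit μ =
      ∫⁻ ω, ∫⁻ x, f (Function.update ω c (x + μ c.1)) ∂gaussianReal 0 1 ∂gaussianBandit μ := by
  have hu := measurable_update_uncurry c
  conv_lhs => rw [← map_update_gaussianBandit μ c]
  rw [lintegral_map hf hu, lintegral_prod _ (by exact (hf.comp hu).aemeasurable)]
  refine lintegral_congr fun ω => ?_
  have : gaussianReal (μ c.1) 1 = (gaussianReal 0 1).map (· + μ c.1) := by
    rw [gaussianReal_map_add_const, zero_add]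
  have hg : Measurable fun x => f (Function.update ω c x) :=
    hf.comp (hu.comp measurable_prodMk_left)
  rw [this, lintegral_map hg (by fun_prop)]

namespace SamplingRule

variable {K : ℕ} (S : SamplingRule K)

/-- The reward table in which the reward of round `t` is replaced by `x`. -/
def resample (t : ℕ) (ω : RewardTable K) (x : ℝ) : RewardTable K :=
  Function.update ω (S.cell t ω) x

theorem measurable_resample (t : ℕ) :
    Measurable fun q : RewardTable K × ℝ => S.resample t q.1 q.2 := by
  have h : Measurable fun q : (Fin K × ℕ) × (RewardTable K × ℝ) =>
      Function.update q.2.1 q.1 q.2.2 :=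
    measurable_from_prod_countable_right fun c => measurable_update_uncurry c
  exact h.comp (((S.measurable_cell t).comp measurable_fst).prodMk measurable_id)

/-- The cell is random, so the integral is split over its countably many values. Overwriting the
fixed cell `c` preserves the event that `c` is the cell read, which reduces each piece to
`lintegral_update_gaussianBandit`. -/
theorem lintegral_resample (μ : Fin K → ℝ) (t : ℕ) {f : RewardTable K → ℝ≥0∞}
    (hf : Measurable f) :
    ∫⁻ ω, f ω ∂gaussianBandit μ =
      ∫⁻ ω, ∫⁻ x, f (S.resample t ω (x + μ (S.arm t ω))) ∂gaussianReal 0 1 ∂gaussianBandit μ := by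
  have hmc : ∀ c, MeasurableSet {ω | S.cell t ω = c} := fun c =>
    S.measurable_cell t (measurableSet_singleton c)
  have hsum : ∀ g : RewardTable K → ℝ≥0∞, Measurable g → ∫⁻ ω, g ω ∂gaussianBandit μ =
      ∑' c, ∫⁻ ω, {ω | S.cell t ω = c}.indicator g ω ∂gaussianBandit μ := by
    intro g hg
    rw [← lintegral_tsum fun c => (hg.indicator (hmc c)).aemeasurable]
    refine lintegral_congr fun ω => ?_
    rw [tsum_eq_single (S.cell t ω)]
    · simp
    · intro c hc
      simp [Ne.symm hc]
  have hmarm : Measurable fun ω => μ (S.arm t ω) :=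
    (measurable_of_finite μ).comp (S.measurable_arm t)
  have hm : Measurable fun q : RewardTable K × ℝ =>
      f (S.resample t q.1 (q.2 + μ (S.arm t q.1))) :=
    hf.comp ((S.measurable_resample t).comp
      (measurable_fst.prodMk (measurable_snd.add (hmarm.comp measurable_fst))))
  rw [hsum f hf, hsum _ hm.lintegral_prod_right']
  refine tsum_congr fun c => ?_
  rw [lintegral_update_gaussianBandit μ c (hf.indicator (hmc c))]
  refine lintegral_congr fun ω => ?_
  by_cases h : S.cell t ω = c
  · have harm : S.arm t ω = c.1 := congrArg Prod.fst h
    rw [Set.indicator_of_mem (by exact h)]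
    refine lintegral_congr fun x => ?_
    rw [Set.indicator_of_mem (by exact (S.cell_update_eq_iff t ω c _).2 h), resample, h, harm]
  · rw [Set.indicator_of_notMem (by exact h)]
    refine (lintegral_congr fun x => ?_).trans lintegral_zero
    rw [Set.indicator_of_notMem (by exact fun h' => h ((S.cell_update_eq_iff t ω c _).1 h'))]

end SamplingRule

end UnimodalBAI

/-! ### Change of measure and the expected log-likelihood ratio. -/

namespace UnimodalBAI

theorem lintegral_gaussianReal_add_const (a : ℝ) {f : ℝ → ℝ≥0∞} (hf : Measurable f) :
    ∫⁻ x, f (x + a) ∂gaussianReal 0 1 =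
      ∫⁻ x, ENNReal.ofReal (Real.exp (a * x - a ^ 2 / 2)) * f x ∂gaussianReal 0 1 := by
  have h1 : ∫⁻ x, f (x + a) ∂gaussianReal 0 1 = ∫⁻ x, f x ∂gaussianReal a 1 := by
    have : gaussianReal a 1 = (gaussianReal 0 1).map (· + a) := by
      rw [gaussianReal_map_add_const, zero_add]
    rw [this, lintegral_map hf (by fun_prop)]
  rw [h1, gaussianReal_of_var_ne_zero _ one_ne_zero, gaussianReal_of_var_ne_zero _ one_ne_zero,
    lintegral_withDensity_eq_lintegral_mul _ (measurable_gaussianPDF _ _) hf,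
    lintegral_withDensity_eq_lintegral_mul _ (measurable_gaussianPDF _ _) (by fun_prop)]
  refine lintegral_congr fun x => ?_
  simp only [Pi.mul_apply]
  rw [← mul_assoc]
  congr 1
  rw [gaussianPDF, gaussianPDF, ← ENNReal.ofReal_mul (gaussianPDFReal_nonneg _ _ _)]
  congr 1
  rw [gaussianPDFReal, gaussianPDFReal, mul_assoc _ (Real.exp _), ← Real.exp_add]
  congr 2
  simp only [NNReal.coe_one]
  ring

namespace SamplingRule

variable {K : ℕ} (S : SamplingRule K)

theorem measurable_reward (t : ℕ) : Measurable (reward S.arm t) :=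
  UnimodalBAI.measurable_reward fun s _ => S.measurable_arm s

theorem measurable_mean_arm (μ : Fin K → ℝ) (t : ℕ) : Measurable fun ω => μ (S.arm t ω) :=
  (measurable_of_finite μ).comp (S.measurable_arm t)

/-- The log-likelihood ratio, after `t` rounds, of the instance with means `μ` with respect to the
instance all of whose means are `0`. -/
noncomputable def logLikelihood (μ : Fin K → ℝ) (t : ℕ) (ω : RewardTable K) : ℝ :=
  ∑ s ∈ Finset.range t, (μ (S.arm s ω) * reward S.arm s ω - μ (S.arm s ω) ^ 2 / 2)

theorem measurable_logLikelihood (μ : Fin K → ℝ) (t : ℕ) : Measurable (S.logLikelihood μ t) :=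
  Finset.measurable_sum _ fun s _ =>
    ((S.measurable_mean_arm μ s).mul (S.measurable_reward s)).sub
      (((S.measurable_mean_arm μ s).pow_const 2).div_const 2)

theorem logLikelihood_eq_of_sameHistory (μ : Fin K → ℝ) {t : ℕ} {ω ω' : RewardTable K}
    (h : SameHistory S.arm t ω ω') : S.logLikelihood μ t ω = S.logLikelihood μ t ω' := by
  refine Finset.sum_congr rfl fun s hs => ?_
  rw [(h s (Finset.mem_range.1 hs)).1, (h s (Finset.mem_range.1 hs)).2]

theorem sameHistory_resample (t : ℕ) (ω : RewardTable K) (x : ℝ) :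
    SameHistory S.arm t (S.resample t ω x) ω :=
  S.sameHistory_update t ω x

theorem arm_resample (t : ℕ) (ω : RewardTable K) (x : ℝ) :
    S.arm t (S.resample t ω x) = S.arm t ω :=
  S.arm_eq_of_sameHistory (S.sameHistory_resample t ω x)

theorem reward_resample (t : ℕ) (ω : RewardTable K) (x : ℝ) :
    reward S.arm t (S.resample t ω x) = x :=
  S.reward_update t ω x

theorem logLikelihood_resample (μ : Fin K → ℝ) (t : ℕ) (ω : RewardTable K) (x : ℝ) :
    S.logLikelihood μ (t + 1) (S.resample t ω x) =
      S.logLikelihood μ t ω + (μ (S.arm t ω) * x - μ (S.arm t ω) ^ 2 / 2) := by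
  have h := S.logLikelihood_eq_of_sameHistory μ (S.sameHistory_resample t ω x)
  rw [← h, logLikelihood, Finset.sum_range_succ, S.arm_resample, S.reward_resample]
  rfl

/-- Redrawing the last reward on both sides leaves an inner integral that depends only on the first
`t` rounds, to which the induction hypothesis applies. The Gaussian shift by the mean of the pulled
arm contributes exactly the last factor of the likelihood ratio. -/
theorem lintegral_change_of_measure (μ : Fin K → ℝ) (t : ℕ) {f : RewardTable K → ℝ≥0∞}
    (hf : Measurable f) (hinv : ∀ ω ω', SameHistory S.arm t ω ω' → f ω = f ω') :
    ∫⁻ ω, f ω ∂gaussianBandit μ =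
      ∫⁻ ω, ENNReal.ofReal (Real.exp (S.logLikelihood μ t ω)) * f ω
        ∂gaussianBandit (0 : Fin K → ℝ) := by
  induction t generalizing f with
  | zero =>
    have h : ∀ ω, f ω = f 0 := fun ω => hinv _ _ fun s hs => absurd hs (Nat.not_lt_zero s)
    simp_rw [h]
    simp [logLikelihood]
  | succ t ih =>
    have hm : Measurable fun q : RewardTable K × ℝ =>
        f (S.resample t q.1 (q.2 + μ (S.arm t q.1))) :=
      hf.comp ((S.measurable_resample t).comp (measurable_fst.prodMk
        (measurable_snd.add ((S.measurable_mean_arm μ t).comp measurable_fst))))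
    have hL := S.measurable_logLikelihood μ (t + 1)
    have h0 := S.lintegral_resample 0 t
      (f := fun ω => ENNReal.ofReal (Real.exp (S.logLikelihood μ (t + 1) ω)) * f ω) (by fun_prop)
    rw [S.lintegral_resample μ t hf, ih hm.lintegral_prod_right', h0]
    · refine lintegral_congr fun ω => ?_
      have hfr : Measurable fun x => f (S.resample t ω x) :=
        hf.comp ((S.measurable_resample t).comp measurable_prodMk_left)
      dsimp only
      rw [lintegral_gaussianReal_add_const (μ (S.arm t ω)) hfr,
        ← lintegral_const_mul _ (by exact Measurable.mul (by fun_prop) hfr)]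
      refine lintegral_congr fun x => ?_
      rw [Pi.zero_apply, add_zero, S.logLikelihood_resample, Real.exp_add,
        ENNReal.ofReal_mul (Real.exp_nonneg _), mul_assoc]
    · intro ω ω' h
      refine lintegral_congr fun x => ?_
      rw [S.arm_eq_of_sameHistory h]
      exact hinv _ _ (S.sameHistory_update_succ h _)

theorem measure_change_of_measure (μ : Fin K → ℝ) (t : ℕ) {B : Set (RewardTable K)}
    (hB : MeasurableSet[historySigma S.arm t] B) :
    gaussianBandit μ B = ∫⁻ ω in B, ENNReal.ofReal (Real.exp (S.logLikelihood μ t ω))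
        ∂gaussianBandit (0 : Fin K → ℝ) := by
  have hB' : MeasurableSet B := S.filtration.le t B hB
  rw [← lintegral_indicator_one hB', ← lintegral_indicator hB',
    S.lintegral_change_of_measure μ t (measurable_one.indicator hB')]
  · refine lintegral_congr fun ω => ?_
    by_cases h : ω ∈ B <;> simp [h]
  · intro ω ω' h
    have := h.mem_iff hB
    by_cases h : ω ∈ B
    · simp [h, this.1 h]
    · simp [h, mt this.2 h]

theorem integrable_exp_logLikelihood (μ : Fin K → ℝ) (t : ℕ) :
    Integrable (fun ω => Real.exp (S.logLikelihood μ t ω)) (gaussianBandit (0 : Fin K → ℝ)) := by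
  have hL := S.measurable_logLikelihood μ t
  refine (lintegral_ofReal_ne_top_iff_integrable (by fun_prop)
    (Filter.Eventually.of_forall fun ω => Real.exp_nonneg _)).1 ?_
  have h := S.measure_change_of_measure μ t (B := Set.univ) MeasurableSet.univ
  rw [Measure.restrict_univ, measure_univ] at h
  rw [← h]
  exact ENNReal.one_ne_top

theorem measureReal_change_of_measure (μ : Fin K → ℝ) (t : ℕ) {B : Set (RewardTable K)}
    (hB : MeasurableSet[historySigma S.arm t] B) :
    (gaussianBandit μ).real B =
      ∫ ω in B, Real.exp (S.logLikelihood μ t ω) ∂gaussianBandit (0 : Fin K → ℝ) := by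
  rw [measureReal_def, S.measure_change_of_measure μ t hB,
    ← ofReal_integral_eq_lintegral_ofReal (S.integrable_exp_logLikelihood μ t).integrableOn
      (Filter.Eventually.of_forall fun ω => Real.exp_nonneg _),
    ENNReal.toReal_ofReal (integral_nonneg fun ω => Real.exp_nonneg _)]

theorem measurePreserving_resample (t : ℕ) :
    MeasurePreserving (fun q : RewardTable K × ℝ => S.resample t q.1 q.2)
      ((gaussianBandit (0 : Fin K → ℝ)).prod (gaussianReal 0 1))
      (gaussianBandit (0 : Fin K → ℝ)) := by
  refine ⟨S.measurable_resample t, Measure.ext_of_lintegral _ fun f hf => ?_⟩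
  rw [lintegral_map hf (S.measurable_resample t),
    lintegral_prod _ (by exact (hf.comp (S.measurable_resample t)).aemeasurable),
    S.lintegral_resample 0 t hf]
  simp

theorem integrable_mean_arm (μ ν : Fin K → ℝ) (t : ℕ) :
    Integrable (fun ω => ν (S.arm t ω)) (gaussianBandit μ) := by
  refine Integrable.of_bound (S.measurable_mean_arm ν t).aestronglyMeasurable (∑ k, |ν k|)
    (Filter.Eventually.of_forall fun ω => ?_)
  exact Finset.single_le_sum (f := fun k => |ν k|) (fun _ _ => abs_nonneg _) (Finset.mem_univ _)

theorem integrable_mean_arm_mul_reward (μ : Fin K → ℝ) (t : ℕ) :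
    Integrable (fun ω => μ (S.arm t ω) * reward S.arm t ω) (gaussianBandit (0 : Fin K → ℝ)) := by
  have hm : Measurable fun ω => μ (S.arm t ω) * reward S.arm t ω :=
    (S.measurable_mean_arm μ t).mul (S.measurable_reward t)
  rw [← (S.measurePreserving_resample t).integrable_comp hm.aestronglyMeasurable]
  have h : Integrable (fun x : ℝ => x) (gaussianReal 0 1) :=
    (memLp_id_gaussianReal' 1 ENNReal.one_ne_top).integrable le_rfl
  refine ((S.integrable_mean_arm 0 μ t).mul_prod h).congr (Filter.Eventually.of_forall fun q => ?_)
  simp [S.arm_resample, S.reward_resample]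

theorem integral_mean_arm_mul_reward (μ : Fin K → ℝ) (t : ℕ) :
    ∫ ω, μ (S.arm t ω) * reward S.arm t ω ∂gaussianBandit (0 : Fin K → ℝ) = 0 := by
  have hm : Measurable fun ω => μ (S.arm t ω) * reward S.arm t ω :=
    (S.measurable_mean_arm μ t).mul (S.measurable_reward t)
  rw [← (S.measurePreserving_resample t).map_eq, integral_map
    (S.measurable_resample t).aemeasurable hm.aestronglyMeasurable]
  simp only [S.arm_resample, S.reward_resample]
  rw [integral_prod_mul (fun ω => μ (S.arm t ω)) (fun x : ℝ => x), integral_id_gaussianReal,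
    mul_zero]

theorem integrable_logLikelihood (μ : Fin K → ℝ) (t : ℕ) :
    Integrable (S.logLikelihood μ t) (gaussianBandit (0 : Fin K → ℝ)) :=
  integrable_finsetSum _ fun s _ => (S.integrable_mean_arm_mul_reward μ s).sub
    (S.integrable_mean_arm 0 (fun k => μ k ^ 2 / 2) s)

theorem integral_logLikelihood (μ : Fin K → ℝ) (t : ℕ) :
    ∫ ω, S.logLikelihood μ t ω ∂gaussianBandit (0 : Fin K → ℝ) =
      -∑ s ∈ Finset.range t, ∫ ω, μ (S.arm s ω) ^ 2 / 2 ∂gaussianBandit (0 : Fin K → ℝ) := by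
  have h2 := fun s => S.integrable_mean_arm 0 (fun k => μ k ^ 2 / 2) s
  simp only [logLikelihood]
  rw [integral_finsetSum _ fun s _ => by
      exact (S.integrable_mean_arm_mul_reward μ s).sub (h2 s), ← Finset.sum_neg_distrib]
  refine Finset.sum_congr rfl fun s _ => ?_
  rw [integral_sub (S.integrable_mean_arm_mul_reward μ s) (h2 s),
    S.integral_mean_arm_mul_reward, zero_sub]

theorem sum_integral_logLikelihood_spikeMean (Δ : ℝ) (t : ℕ) :
    ∑ k, ∫ ω, S.logLikelihood (spikeMean Δ k) t ω ∂gaussianBandit (0 : Fin K → ℝ) =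
      -(t * (Δ ^ 2 / 2)) := by
  simp_rw [S.integral_logLikelihood]
  rw [Finset.sum_neg_distrib, Finset.sum_comm]
  congr 1
  have h : ∀ s, ∑ k, ∫ ω, spikeMean Δ k (S.arm s ω) ^ 2 / 2 ∂gaussianBandit (0 : Fin K → ℝ) =
      Δ ^ 2 / 2 := by
    intro s
    rw [← integral_finsetSum _ fun k _ =>
      S.integrable_mean_arm 0 (fun j => spikeMean Δ k j ^ 2 / 2) s]
    -- Only the spike located at the pulled arm contributes.
    have : ∀ ω, ∑ k, spikeMean Δ k (S.arm s ω) ^ 2 / 2 = Δ ^ 2 / 2 := by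
      intro ω
      rw [Finset.sum_eq_single (S.arm s ω)]
      · simp [spikeMean]
      · intro k _ hk
        simp [spikeMean, Ne.symm hk]
      · simp
    simp [this]
  simp [h]

end SamplingRule

/-- A linearised form of the Donsker–Varadhan inequality for the density `exp Z`. -/
theorem integral_le_of_event {Ω : Type*} [MeasurableSpace Ω] {P : Measure Ω}
    [IsProbabilityMeasure P] {Z : Ω → ℝ} (hZ : Integrable Z P)
    (hexp : Integrable (fun ω => Real.exp (Z ω)) P) (hone : ∫ ω, Real.exp (Z ω) ∂P = 1)
    {A : Set Ω} (hA : MeasurableSet A) {u v : ℝ} (hu : 0 < u) (hv : 0 < v) :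
    ∫ ω, Z ω ∂P ≤ u * (∫ ω in A, Real.exp (Z ω) ∂P) + v * (1 - ∫ ω in A, Real.exp (Z ω) ∂P) - 1
      - P.real A * Real.log u - (1 - P.real A) * Real.log v := by
  -- This is `1 + x ≤ exp x` at `x = z + log w`. The weight `w` is free, and is taken to be `u` on
  -- `A` and `v` off `A`.
  have key : ∀ w : ℝ, 0 < w → ∀ z : ℝ, z ≤ w * Real.exp z - (1 + Real.log w) := by
    intro w hw z
    have := Real.add_one_le_exp (z + Real.log w)
    rw [Real.exp_add, Real.exp_log hw] at this
    linarith
  have hint : ∀ (w : ℝ), 0 < w → ∀ B : Set Ω, ∫ ω in B, Z ω ∂P ≤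
      w * (∫ ω in B, Real.exp (Z ω) ∂P) - P.real B * (1 + Real.log w) := by
    intro w hw B
    calc ∫ ω in B, Z ω ∂P
        ≤ ∫ ω in B, (w * Real.exp (Z ω) - (1 + Real.log w)) ∂P :=
          integral_mono hZ.integrableOn
            ((hexp.integrableOn.const_mul w).sub (integrable_const _)) fun ω => key w hw _
      _ = _ := by
          rw [integral_sub (hexp.integrableOn.const_mul w) (integrable_const _),
            integral_const_mul, setIntegral_const, smul_eq_mul]
  have h1 := hint u hu A
  have h2 := hint v hv Aᶜ
  have h3 := integral_add_compl hA hZ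
  have h4 := integral_add_compl hA hexp
  have h5 := probReal_compl_eq_one_sub (μ := P) hA
  rw [h5] at h2
  have h6 : ∫ ω in Aᶜ, Real.exp (Z ω) ∂P = 1 - ∫ ω in A, Real.exp (Z ω) ∂P := by linarith
  rw [h6] at h2
  linarith

end UnimodalBAI

/-! ### Error probabilities and the sample complexity bound. -/

namespace UnimodalBAI

theorem isBestArm_spikeMean {K : ℕ} {Δ : ℝ} (hΔ : 0 < Δ) (i : Fin K) :
    IsBestArm (spikeMean Δ i) i := fun j hj => by simpa [spikeMean, hj] using hΔ

theorem spikeMean_mem_unimodalMeans {K : ℕ} {Δ : ℝ} (hΔ : 0 < Δ) (i : Fin K) :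
    spikeMean Δ i ∈ unimodalMeans K := by
  refine ⟨i, isBestArm_spikeMean hΔ i, ?_, ?_⟩
  · intro a _ b hb hab
    by_cases ha : a = i
    · subst ha
      rw [le_antisymm hab hb]
    · simp only [spikeMean, ha, if_false]
      split_ifs <;> linarith
  · intro a ha b _ hab
    by_cases hb : b = i
    · subst hb
      rw [le_antisymm hab ha]
    · simp only [spikeMean, hb, if_false]
      split_ifs <;> linarith

namespace Strategy

variable {K : ℕ} (A : Strategy K)

/-- The event that the strategy has stopped after at most `t` rounds and recommends arm `k`. -/
def answerEvent (t : ℕ) (k : Fin K) : Set (RewardTable K) :=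
  {ω | A.answer ω = k} ∩ {ω | A.τ ω ≤ t}

theorem measurableSet_answerEvent (t : ℕ) (k : Fin K) :
    MeasurableSet[historySigma A.arm t] (A.answerEvent t k) :=
  (A.measurable_answer (measurableSet_singleton k)).2 t

theorem measurableSet_answerEvent' (t : ℕ) (k : Fin K) : MeasurableSet (A.answerEvent t k) :=
  A.filtration.le t _ (A.measurableSet_answerEvent t k)

theorem measurableSet_lt_τ (t : ℕ) : MeasurableSet {ω | (t : WithTop ℕ) < A.τ ω} := by
  have h : MeasurableSet {ω | A.τ ω ≤ t} := A.filtration.le t _ (A.isStoppingTime t)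
  convert h.compl using 1
  ext ω
  simp

theorem sum_measureReal_answerEvent_le_one (t : ℕ) (P : Measure (RewardTable K))
    [IsProbabilityMeasure P] : ∑ k, P.real (A.answerEvent t k) ≤ 1 := by
  rw [← measureReal_biUnion_finset]
  · exact measureReal_le_one
  · intro i _ j _ hij
    refine Set.disjoint_left.2 fun ω hi hj => hij ?_
    exact hi.1.symm.trans hj.1
  · exact fun k _ => A.measurableSet_answerEvent' t k

theorem one_le_answerEvent_add_lt_τ {A : Strategy K} {δ : ℝ} (hA : A.IsDeltaCorrect δ)
    {μ : Fin K → ℝ} (hμ : μ ∈ unimodalMeans K) {k : Fin K} (hk : IsBestArm μ k) (t : ℕ) :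
    1 ≤ (gaussianBandit μ).real (A.answerEvent t k) + δ +
      (gaussianBandit μ).real {ω | (t : WithTop ℕ) < A.τ ω} := by
  have hcover : (Set.univ : Set (RewardTable K)) ⊆
      (A.answerEvent t k ∪ {ω | A.τ ω < ⊤ ∧ A.answer ω ≠ k}) ∪
        {ω | (t : WithTop ℕ) < A.τ ω} := by
    intro ω _
    by_cases h : A.τ ω ≤ t
    · left
      by_cases ha : A.answer ω = k
      · exact Or.inl ⟨ha, h⟩
      · exact Or.inr ⟨h.trans_lt (WithTop.coe_lt_top t), ha⟩
    · exact Or.inr (not_le.1 h)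
  calc (1 : ℝ) = (gaussianBandit μ).real Set.univ := probReal_univ.symm
    _ ≤ _ := measureReal_mono hcover
    _ ≤ _ := measureReal_union_le _ _
    _ ≤ _ := by
      gcongr
      exact (measureReal_union_le _ _).trans (by gcongr; exact hA μ hμ k hk)

/-- The weights are `1 ∓ 1/3`. Since the `P₀`-probabilities sum to at most `1 ≤ K/2`, the logarithms
combine into `-(K/2) * log (8/9) ≤ K/16`. Then `K/3 + K/16 + tΔ²/2`, divided by `v - u = 2/3`, is
the right-hand side. -/
theorem sum_measureReal_answerEvent_le (Δ : ℝ) (hK : 2 ≤ K) (t : ℕ) :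
    ∑ k, (gaussianBandit (spikeMean Δ k)).real (A.answerEvent t k) ≤
      19 / 32 * K + 3 / 4 * t * Δ ^ 2 := by
  set P₀ := gaussianBandit (0 : Fin K → ℝ)
  have hk : ∀ k, ∫ ω, A.logLikelihood (spikeMean Δ k) t ω ∂P₀ ≤
      4 / 3 - 1 - Real.log (4 / 3)
        - 2 / 3 * (gaussianBandit (spikeMean Δ k)).real (A.answerEvent t k)
        + (Real.log (4 / 3) - Real.log (2 / 3)) * P₀.real (A.answerEvent t k) := by
    intro k
    have hone := A.measureReal_change_of_measure (spikeMean Δ k) t (B := Set.univ)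
      MeasurableSet.univ
    rw [probReal_univ, Measure.restrict_univ] at hone
    have h := integral_le_of_event (A.integrable_logLikelihood (spikeMean Δ k) t)
      (A.integrable_exp_logLikelihood (spikeMean Δ k) t) hone.symm
      (A.measurableSet_answerEvent' t k) (u := 2 / 3) (v := 4 / 3) (by norm_num) (by norm_num)
    rw [← A.measureReal_change_of_measure _ t (A.measurableSet_answerEvent t k)] at h
    linarith
  have hsum := Finset.sum_le_sum fun k (_ : k ∈ Finset.univ) => hk k
  rw [A.sum_integral_logLikelihood_spikeMean, Finset.sum_add_distrib, Finset.sum_sub_distrib,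
    ← Finset.mul_sum, ← Finset.mul_sum, Finset.sum_const, Finset.card_univ, Fintype.card_fin,
    nsmul_eq_mul] at hsum
  have hp := A.sum_measureReal_answerEvent_le_one t P₀
  have hlog : Real.log (2 / 3) ≤ Real.log (4 / 3) :=
    Real.log_le_log (by norm_num) (by norm_num)
  have hlog' : -(1 / 8) ≤ Real.log (2 / 3) + Real.log (4 / 3) := by
    rw [← Real.log_mul (by norm_num) (by norm_num)]
    refine le_trans ?_ (Real.one_sub_inv_le_log_of_pos (by norm_num))
    norm_num
  have hK' : (2 : ℝ) ≤ K := by exact_mod_cast hK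
  have h1 : (Real.log (4 / 3) - Real.log (2 / 3)) * ∑ k, P₀.real (A.answerEvent t k) ≤
      (Real.log (4 / 3) - Real.log (2 / 3)) * (K / 2) :=
    mul_le_mul_of_nonneg_left (by linarith) (by linarith)
  have h2 : -(1 / 8) * (K / 2 : ℝ) ≤ (Real.log (2 / 3) + Real.log (4 / 3)) * (K / 2) :=
    mul_le_mul_of_nonneg_right hlog' (by positivity)
  linarith

/-- The constant is `5/32 = 1 - 1/4 - 19/32`. -/
theorem le_sum_measureReal_lt_τ {A : Strategy K} {δ : ℝ} (hA : A.IsDeltaCorrect δ)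
    (hδ : δ ≤ 1 / 4) {Δ : ℝ} (hΔ : 0 < Δ) (hK : 2 ≤ K) (t : ℕ) :
    5 / 32 * K - 3 / 4 * t * Δ ^ 2 ≤
      ∑ k, (gaussianBandit (spikeMean Δ k)).real {ω | (t : WithTop ℕ) < A.τ ω} := by
  have h1 := Finset.sum_le_sum fun k (_ : k ∈ Finset.univ) => one_le_answerEvent_add_lt_τ hA
    (spikeMean_mem_unimodalMeans hΔ k) (isBestArm_spikeMean hΔ k) t
  rw [Finset.sum_add_distrib, Finset.sum_add_distrib, Finset.sum_const, Finset.sum_const,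
    Finset.card_univ, Fintype.card_fin, nsmul_eq_mul, nsmul_eq_mul] at h1
  have h2 := A.sum_measureReal_answerEvent_le Δ hK t
  have h3 : (K : ℝ) * δ ≤ K * (1 / 4) := mul_le_mul_of_nonneg_left hδ (by positivity)
  linarith

theorem sum_measure_lt_τ_le_expectedSamples (μ : Fin K → ℝ) (n : ℕ) :
    ∑ t ∈ Finset.range n, gaussianBandit μ {ω | (t : WithTop ℕ) < A.τ ω} ≤
      A.expectedSamples μ := by
  have h : ∀ t : ℕ, gaussianBandit μ {ω | (t : WithTop ℕ) < A.τ ω} =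
      ∫⁻ ω, {ω | (t : WithTop ℕ) < A.τ ω}.indicator 1 ω ∂gaussianBandit μ :=
    fun t => (lintegral_indicator_one (A.measurableSet_lt_τ t)).symm
  simp_rw [h]
  rw [← lintegral_finsetSum _ fun t _ => measurable_one.indicator (A.measurableSet_lt_τ t)]
  refine lintegral_mono fun ω => ?_
  have hcard : ∑ t ∈ Finset.range n,
      {ω | (t : WithTop ℕ) < A.τ ω}.indicator (1 : RewardTable K → ℝ≥0∞) ω =
      (((Finset.range n).filter fun t : ℕ => (t : WithTop ℕ) < A.τ ω).card : ℝ≥0∞) := by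
    rw [Finset.card_filter]
    push_cast
    exact Finset.sum_congr rfl fun t _ => by simp [Set.indicator_apply]
  rw [hcard]
  cases hτ : A.τ ω with
  | top => exact le_top
  | coe m =>
    have : ((Finset.range n).filter fun t : ℕ => (t : WithTop ℕ) < (m : WithTop ℕ)).card ≤ m := by
      refine (Finset.card_le_card fun t ht => ?_).trans (Finset.card_range m).le
      exact Finset.mem_range.2 (WithTop.coe_lt_coe.1 (Finset.mem_filter.1 ht).2)
    exact (Nat.cast_le.2 this).trans (ENat.toENNReal_coe m).ge

theorem le_sum_expectedSamples {A : Strategy K} {δ : ℝ} (hA : A.IsDeltaCorrect δ)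
    (hδ : δ ≤ 1 / 4) {Δ : ℝ} (hΔ : 0 < Δ) (hK : 2 ≤ K) :
    ENNReal.ofReal (K * (K / (64 * Δ ^ 2))) ≤
      ∑ k : Fin K, A.expectedSamples (spikeMean Δ k) := by
  have hK' : (2 : ℝ) ≤ K := by exact_mod_cast hK
  -- `y` is the real time at which the lower bound of `le_sum_measureReal_lt_τ` reaches zero.
  set y : ℝ := 5 * K / (24 * Δ ^ 2) with hy
  have hy0 : 0 < y := by positivity
  have hyK : 24 * Δ ^ 2 * y = 5 * K := by
    rw [hy]
    field_simp
  set n := ⌈y⌉₊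
  have hn1 : y ≤ n := Nat.le_ceil y
  have hn2 : (n : ℝ) < y + 1 := Nat.ceil_lt_add_one hy0.le
  have hgauss : ∀ n : ℕ, ∑ t ∈ Finset.range n, (5 / 32 * K - 3 / 4 * t * Δ ^ 2 : ℝ) =
      5 / 32 * K * n - 3 / 8 * (n * (n - 1)) * Δ ^ 2 := by
    intro n
    induction n with
    | zero => simp
    | succ n ih =>
      rw [Finset.sum_range_succ, ih]
      push_cast
      ring
  have hmain : (K : ℝ) * (K / (64 * Δ ^ 2)) ≤
      5 / 32 * K * n - 3 / 8 * (n * (n - 1)) * Δ ^ 2 := by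
    have hKy : (K : ℝ) = 24 * Δ ^ 2 * y / 5 := by linarith
    have hl : (K : ℝ) * (K / (64 * Δ ^ 2)) = Δ ^ 2 * (9 / 25 * y ^ 2) := by
      rw [hKy]
      field_simp
      ring
    have hr : 5 / 32 * (K : ℝ) * n - 3 / 8 * (n * (n - 1)) * Δ ^ 2 =
        Δ ^ 2 * (3 / 4 * y * n - 3 / 8 * (n * (n - 1))) := by
      rw [hKy]
      ring
    rw [hl, hr]
    refine mul_le_mul_of_nonneg_left ?_ (by positivity)
    -- From `(n - y) * (y + 1 - n) ≥ 0` follows `n * (2 * y - n + 1) ≥ y ^ 2 + y`, so rounding `y`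
    -- up costs nothing, and `3/8 ≥ 9/25`.
    nlinarith [mul_nonneg (sub_nonneg.2 hn1) (sub_nonneg.2 hn2.le), sq_nonneg y]
  calc ENNReal.ofReal (K * (K / (64 * Δ ^ 2)))
      ≤ ENNReal.ofReal (∑ t ∈ Finset.range n, ∑ k,
          (gaussianBandit (spikeMean Δ k)).real {ω | (t : WithTop ℕ) < A.τ ω}) := by
        refine ENNReal.ofReal_le_ofReal (hmain.trans ?_)
        rw [← hgauss]
        exact Finset.sum_le_sum fun t _ => le_sum_measureReal_lt_τ hA hδ hΔ hK t
    _ = ∑ k : Fin K, ∑ t ∈ Finset.range n,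
          gaussianBandit (spikeMean Δ k) {ω | (t : WithTop ℕ) < A.τ ω} := by
        rw [Finset.sum_comm, ENNReal.ofReal_sum_of_nonneg fun k _ =>
          Finset.sum_nonneg fun t _ => measureReal_nonneg]
        refine Finset.sum_congr rfl fun k _ => ?_
        rw [ENNReal.ofReal_sum_of_nonneg fun t _ => measureReal_nonneg]
        exact Finset.sum_congr rfl fun t _ => ofReal_measureReal
    _ ≤ _ := Finset.sum_le_sum fun k _ => A.sum_measure_lt_τ_le_expectedSamples _ n

end Strategy

end UnimodalBAI

open UnimodalBAI in
theorem theorem3 (K : ℕ) (hK : 2 ≤ K) (Δ : ℝ) (hΔ : 0 < Δ) (δ : ℝ) (hδ : δ ≤ 1 / 4)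
    (A : Strategy K) (hA : A.IsDeltaCorrect δ) :
    ENNReal.ofReal ((K : ℝ) / (64 * Δ ^ 2)) ≤
        (K : ℝ≥0∞)⁻¹ * ∑ i : Fin K, A.expectedSamples (spikeMean Δ i) ∧
      ∃ i : Fin K,
        ENNReal.ofReal ((K : ℝ) / (64 * Δ ^ 2)) ≤ A.expectedSamples (spikeMean Δ i) := by
  have hK0 : (K : ℝ≥0∞) ≠ 0 := by exact_mod_cast (by omega : K ≠ 0)
  have havg : ENNReal.ofReal ((K : ℝ) / (64 * Δ ^ 2)) ≤
      (K : ℝ≥0∞)⁻¹ * ∑ i : Fin K, A.expectedSamples (spikeMean Δ i) := by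
    have h := Strategy.le_sum_expectedSamples hA hδ hΔ hK
    rw [ENNReal.ofReal_mul (Nat.cast_nonneg K), ENNReal.ofReal_natCast] at h
    calc _ = (K : ℝ≥0∞)⁻¹ * (K * ENNReal.ofReal ((K : ℝ) / (64 * Δ ^ 2))) := by
          rw [← mul_assoc, ENNReal.inv_mul_cancel hK0 (ENNReal.natCast_ne_top K), one_mul]
      _ ≤ _ := by gcongr
  refine ⟨havg, ?_⟩
  obtain ⟨i, -, hi⟩ := Finset.exists_max_image (Finset.univ : Finset (Fin K))
    (fun i => A.expectedSamples (spikeMean Δ i)) ⟨⟨0, by omega⟩, Finset.mem_univ _⟩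
  refine ⟨i, havg.trans ?_⟩
  have hsum := Finset.sum_le_card_nsmul Finset.univ _ _ hi
  rw [Finset.card_univ, Fintype.card_fin, nsmul_eq_mul] at hsum
  calc _ ≤ (K : ℝ≥0∞)⁻¹ * (K * A.expectedSamples (spikeMean Δ i)) := by gcongr
    _ = _ := by
      rw [← mul_assoc, ENNReal.inv_mul_cancel hK0 (ENNReal.natCast_ne_top K), one_mul]
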